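/- Let $(M,g)$ be a compact smooth Riemannian manifold with positive sectional curvature, let $(N,h)$ be a smooth Riemannian manifold, and let $\pi:(M,g)\to(N,h)$ be a nontrivial Riemannian submersion, i.e. $\pi$ is a smooth submersion whose differential $d\pi_x$ restricts to an isometry from $(\ker d\pi_x)^{\perp}$ onto $T_{\pi(x)}N$ for every $x\in M$, and $0<\dim N<\dim M$. Suppose that all fibers of $\pi$ are totally geodesic submanifolds of $M$. Then every fiber $F$ of $\pi$ satisfies $$\dim F<\rho(\dim N)+1,$$ where, for $n\ge 1$, $\rho(n)$ denotes the maximal number $k$ such that there are $k$ smooth tangent vector fields on the unit sphere $S^{n-1}\subset\mathbb{R}^n$ which are linearly independent at every point of $S^{n-1}$. -/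

import Mathlib

open Bundle Manifold Module
open scoped ContDiff Topology

noncomputable section

set_option linter.unusedSectionVars false

namespace RiemSubm

section LeviCivita

variable {E : Type*} [NormedAddCommGroup E] [NormedSpace ℝ E]
  {H : Type*} [TopologicalSpace H] (I : ModelWithCorners ℝ E H)
  {M : Type*} [TopologicalSpace M] [ChartedSpace H M]
  [RiemannianBundle (fun x : M ↦ TangentSpace I x)]

/-- The pointwise inner product `⟨X, Y⟩ : M → ℝ` of two vector fields. -/
def metricFun (X Y : Π x : M, TangentSpace I x) : M → ℝ := fun x ↦ inner ℝ (X x) (Y x)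

/-- Half of the right-hand side of Koszul's formula: the value at `x` of
`(X⟨Y,Z⟩ + Y⟨X,Z⟩ - Z⟨X,Y⟩ + ⟨[X,Y],Z⟩ - ⟨[X,Z],Y⟩ - ⟨[Y,Z],X⟩) / 2`. -/
def koszul (X Y Z : Π x : M, TangentSpace I x) (x : M) : ℝ :=
  (mvfderiv I (metricFun I Y Z) x (X x) + mvfderiv I (metricFun I X Z) x (Y x)
    - mvfderiv I (metricFun I X Y) x (Z x)
    + inner ℝ (VectorField.mlieBracket I X Y x) (Z x)
    - inner ℝ (VectorField.mlieBracket I X Z x) (Y x)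
    - inner ℝ (VectorField.mlieBracket I Y Z x) (X x)) / 2

variable [FiniteDimensional ℝ E] [IsManifold I ∞ M]
  [IsContMDiffRiemannianBundle I ∞ E (fun x : M ↦ TangentSpace I x)]

variable {I}

lemma mdifferentiableAt_metricFun {X Y : Π x : M, TangentSpace I x} {x : M}
    (hX : MDiffAt (T% X) x) (hY : MDiffAt (T% Y) x) : MDiffAt (metricFun I X Y) x :=
  MDifferentiableAt.inner_bundle (IB := I) (F := E) (E := fun x : M ↦ TangentSpace I x)
    (b := id) hX hY

lemma mvfderiv_metricFun_add_left {X X' Y : Π x : M, TangentSpace I x} {x : M}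
    (hX : MDiffAt (T% X) x) (hX' : MDiffAt (T% X') x) (hY : MDiffAt (T% Y) x) :
    mvfderiv I (metricFun I (X + X') Y) x
      = mvfderiv I (metricFun I X Y) x + mvfderiv I (metricFun I X' Y) x := by
  have : metricFun I (X + X') Y = metricFun I X Y + metricFun I X' Y := by
    funext y; simp [metricFun, inner_add_left]
  rw [this]
  exact mvfderiv_add (mdifferentiableAt_metricFun hX hY) (mdifferentiableAt_metricFun hX' hY)

lemma metricFun_comm (X Y : Π x : M, TangentSpace I x) : metricFun I X Y = metricFun I Y X := by
  funext y; exact real_inner_comm _ _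

lemma mvfderiv_metricFun_smul_left {f : M → ℝ} {X Y : Π x : M, TangentSpace I x} {x : M}
    (hf : MDiffAt f x) (hX : MDiffAt (T% X) x) (hY : MDiffAt (T% Y) x) :
    mvfderiv I (metricFun I (f • X) Y) x
      = f x • mvfderiv I (metricFun I X Y) x + inner ℝ (X x) (Y x) • mvfderiv I f x := by
  have : metricFun I (f • X) Y = f * metricFun I X Y := by
    funext y; simp [metricFun, inner_smul_left]
  rw [this]
  exact mvfderiv_mul hf (mdifferentiableAt_metricFun hX hY)

lemma koszul_tensorial_left {Y Z : Π x : M, TangentSpace I x} {x : M}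
    (hY : MDiffAt (T% Y) x) (hZ : MDiffAt (T% Z) x) :
    TensorialAt I E (fun X ↦ koszul I X Y Z x) x where
  smul {f X} hf hX := by
    have hfX : MDiffAt (T% (f • X)) x := hf.smul_section hX
    simp only [koszul, mvfderiv_metricFun_smul_left hf hX hZ, mvfderiv_metricFun_smul_left hf hX hY,
      VectorField.mlieBracket_smul_left hf hX]
    simp [inner_add_left, inner_smul_left, inner_smul_right]
    ring
  add {X X'} hX hX' := by
    simp only [koszul, mvfderiv_metricFun_add_left hX hX' hZ,
      mvfderiv_metricFun_add_left hX hX' hY, VectorField.mlieBracket_add_left hX hX']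
    simp [inner_add_left, inner_add_right]
    ring

lemma koszul_tensorial_right {X Y : Π x : M, TangentSpace I x} {x : M}
    (hX : MDiffAt (T% X) x) (hY : MDiffAt (T% Y) x) :
    TensorialAt I E (fun Z ↦ koszul I X Y Z x) x where
  smul {f Z} hf hZ := by
    simp only [koszul, metricFun_comm Y (f • Z), metricFun_comm X (f • Z), metricFun_comm Y Z,
      metricFun_comm X Z, mvfderiv_metricFun_smul_left hf hZ hX,
      mvfderiv_metricFun_smul_left hf hZ hY, VectorField.mlieBracket_smul_right hf hZ]
    simp [inner_add_left, inner_smul_left, inner_smul_right]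
    ring
  add {Z Z'} hZ hZ' := by
    simp only [koszul, metricFun_comm Y (Z + Z'), metricFun_comm X (Z + Z'), metricFun_comm Y Z,
      metricFun_comm X Z, metricFun_comm Y Z', metricFun_comm X Z', mvfderiv_metricFun_add_left hZ hZ' hX,
      mvfderiv_metricFun_add_left hZ hZ' hY, VectorField.mlieBracket_add_right hZ hZ']
    simp [inner_add_left, inner_add_right]
    ring

lemma koszul_add_middle {X Y Y' Z : Π x : M, TangentSpace I x} {x : M}
    (hX : MDiffAt (T% X) x) (hY : MDiffAt (T% Y) x) (hY' : MDiffAt (T% Y') x)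
    (hZ : MDiffAt (T% Z) x) :
    koszul I X (Y + Y') Z x = koszul I X Y Z x + koszul I X Y' Z x := by
  simp only [koszul, metricFun_comm X (Y + Y'), metricFun_comm X Y, metricFun_comm X Y',
    mvfderiv_metricFun_add_left hY hY' hX, mvfderiv_metricFun_add_left hY hY' hZ,
    VectorField.mlieBracket_add_left hY hY', VectorField.mlieBracket_add_right hY hY']
  simp [inner_add_left, inner_add_right]
  ring

lemma koszul_smul_middle {f : M → ℝ} {X Y Z : Π x : M, TangentSpace I x} {x : M}
    (hf : MDiffAt f x) (hX : MDiffAt (T% X) x) (hY : MDiffAt (T% Y) x)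
    (hZ : MDiffAt (T% Z) x) :
    koszul I X (f • Y) Z x
      = f x * koszul I X Y Z x + mvfderiv I f x (X x) * inner ℝ (Y x) (Z x) := by
  simp only [koszul, metricFun_comm X (f • Y), metricFun_comm X Y,
    mvfderiv_metricFun_smul_left hf hY hX, mvfderiv_metricFun_smul_left hf hY hZ,
    VectorField.mlieBracket_smul_left hf hY, VectorField.mlieBracket_smul_right hf hY]
  simp [inner_add_left, inner_smul_left, inner_smul_right]
  ring

instance finiteDimensional_tangentSpace (x : M) : FiniteDimensional ℝ (TangentSpace I x) :=
  inferInstanceAs (FiniteDimensional ℝ E)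

/-- For `Y` differentiable at `x`, the bilinear form `(v, w) ↦ ⟨∇_v Y, w⟩` on `T_x M`. -/
def koszulForm (Y : Π x : M, TangentSpace I x) (x : M) (hY : MDiffAt (T% Y) x) :
    TangentSpace I x →L[ℝ] TangentSpace I x →L[ℝ] ℝ :=
  TensorialAt.mkHom₂ (F := E) (F' := E) (fun X Z ↦ koszul I X Y Z x) x
    (fun _ hZ ↦ koszul_tensorial_left hY hZ) (fun _ hX ↦ koszul_tensorial_right hX hY)

open scoped Classical in
/-- The Levi-Civita covariant derivative as a function: `leviCivitaFun Y x v = ∇_v Y`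
(and `0` if `Y` is not differentiable at `x`). -/
def leviCivitaFun (Y : Π x : M, TangentSpace I x) (x : M) :
    TangentSpace I x →L[ℝ] TangentSpace I x :=
  if hY : MDiffAt (T% Y) x then
    LinearMap.toContinuousLinearMap
      { toFun := fun v ↦ (InnerProductSpace.toDual ℝ (TangentSpace I x)).symm (koszulForm Y x hY v)
        map_add' := by intro v w; simp
        map_smul' := by intro c v; simp }
  else 0

/-- Koszul's formula. -/
lemma inner_leviCivitaFun {X Y Z : Π x : M, TangentSpace I x} {x : M}
    (hX : MDiffAt (T% X) x) (hY : MDiffAt (T% Y) x) (hZ : MDiffAt (T% Z) x) :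
    inner ℝ (leviCivitaFun Y x (X x)) (Z x) = koszul I X Y Z x := by
  have h : inner ℝ (leviCivitaFun Y x (X x)) (Z x) = koszulForm Y x hY (X x) (Z x) := by
    simp only [leviCivitaFun, dif_pos hY]
    exact InnerProductSpace.toDual_symm_apply
  rw [h]
  exact TensorialAt.mkHom₂_apply (F := E) (F' := E) (Φ := fun X Z ↦ koszul I X Y Z x)
    (fun _ hZ ↦ koszul_tensorial_left hY hZ) (fun _ hX ↦ koszul_tensorial_right hX hY) hX hZ

lemma eq_of_inner_fields {x : M} {v w : TangentSpace I x}
    (h : ∀ Z : Π x : M, TangentSpace I x, MDiffAt (T% Z) x → 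
      inner ℝ v (Z x) = inner ℝ w (Z x)) : v = w := by
  refine ext_inner_right ℝ fun u ↦ ?_
  simpa using h (FiberBundle.extend E u) (FiberBundle.mdifferentiableAt_extend ..)

variable (I M) in
/-- The Levi-Civita connection of the Riemannian manifold `M`. -/
def leviCivita : CovariantDerivative I E (TangentSpace I : M → Type _) where
  toFun := leviCivitaFun
  isCovariantDerivativeOnUniv :=
    { add := by
        intro Y Y' x hY hY' _
        ext1 v
        refine eq_of_inner_fields fun Z hZ ↦ ?_
        have hX := FiberBundle.mdifferentiableAt_extend (I := I) (F := E) v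
        have hv : FiberBundle.extend E v x = v := FiberBundle.extend_apply_self ..
        have hYY' : MDiffAt (T% (Y + Y')) x := mdifferentiableAt_add_section hY hY'
        rw [← hv, inner_leviCivitaFun hX hYY' hZ, koszul_add_middle hX hY hY' hZ,
          add_apply, inner_add_left, inner_leviCivitaFun hX hY hZ,
          inner_leviCivitaFun hX hY' hZ]
      leibniz := by
        intro Y g x hY hg _
        ext1 v
        refine eq_of_inner_fields fun Z hZ ↦ ?_
        have hX := FiberBundle.mdifferentiableAt_extend (I := I) (F := E) v
        have hv : FiberBundle.extend E v x = v := FiberBundle.extend_apply_self ..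
        have hgY : MDiffAt (T% (g • Y)) x := hg.smul_section hY
        rw [← hv, inner_leviCivitaFun hX hgY hZ, koszul_smul_middle hg hX hY hZ,
          ← inner_leviCivitaFun hX hY hZ]
        simp [inner_add_left, inner_smul_left] }

/-- The Levi-Civita connection is torsion-free. -/
theorem leviCivita_torsion : (leviCivita I M).torsion = 0 := by
  rw [CovariantDerivative.torsion_eq_zero_iff]
  intro X Y x hX hY
  refine eq_of_inner_fields fun Z hZ ↦ ?_
  have h1 : inner ℝ (leviCivita I M Y x (X x)) (Z x) = _ := inner_leviCivitaFun hX hY hZ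
  have h2 : inner ℝ (leviCivita I M X x (Y x)) (Z x) = _ := inner_leviCivitaFun hY hX hZ
  rw [inner_sub_left, h1, h2, koszul, koszul, metricFun_comm Y X,
    VectorField.mlieBracket_swap_apply (V := Y) (W := X), inner_neg_left]
  ring

/-- The Levi-Civita connection is compatible with the metric: `X⟨Y,Z⟩ = ⟨∇_X Y,Z⟩ + ⟨Y,∇_X Z⟩`. -/
theorem leviCivita_metric {X Y Z : Π x : M, TangentSpace I x} {x : M}
    (hX : MDiffAt (T% X) x) (hY : MDiffAt (T% Y) x) (hZ : MDiffAt (T% Z) x) :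
    mvfderiv I (metricFun I Y Z) x (X x)
      = inner ℝ (leviCivita I M Y x (X x)) (Z x) + inner ℝ (Y x) (leviCivita I M Z x (X x)) := by
  have h1 : inner ℝ (leviCivita I M Y x (X x)) (Z x) = _ := inner_leviCivitaFun hX hY hZ
  have h2 : inner ℝ (leviCivita I M Z x (X x)) (Y x) = _ := inner_leviCivitaFun hX hZ hY
  rw [real_inner_comm] at h2
  rw [h1, h2, koszul, koszul, metricFun_comm Z Y,
    VectorField.mlieBracket_swap_apply (V := Z) (W := Y), inner_neg_left]
  ring

variable (I) in
/-- The curvature `R(X,Y)Z = ∇_X ∇_Y Z - ∇_Y ∇_X Z - ∇_[X,Y] Z` of the Levi-Civita connection. -/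
def curvature (X Y Z : Π x : M, TangentSpace I x) (x : M) : TangentSpace I x :=
  leviCivita I M (fun y ↦ leviCivita I M Z y (Y y)) x (X x)
    - leviCivita I M (fun y ↦ leviCivita I M Z y (X y)) x (Y x)
    - leviCivita I M Z x (VectorField.mlieBracket I X Y x)

variable (I) in
/-- The sectional curvature at `x` of the plane spanned by `X x` and `Y x`,
`⟨R(X,Y)Y, X⟩ / (|X|² |Y|² - ⟨X,Y⟩²)`. -/
def sectionalCurvature (X Y : Π x : M, TangentSpace I x) (x : M) : ℝ :=
  inner ℝ (curvature I X Y Y x) (X x) /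
    (inner ℝ (X x) (X x) * inner ℝ (Y x) (Y x) - inner ℝ (X x) (Y x) ^ 2)

variable (I M) in
/-- All sectional curvatures are positive. A plane in `T_x M` is represented by two local smooth
vector fields that span it at `x`; since curvature is a tensor, the choice does not matter. -/
def HasPositiveSectionalCurvature : Prop :=
  ∀ (U : Set M) (X Y : Π x : M, TangentSpace I x), IsOpen U →
    CMDiff[U] ∞ (T% X) → CMDiff[U] ∞ (T% Y) →
    ∀ x ∈ U, LinearIndependent ℝ ![X x, Y x] → 0 < sectionalCurvature I X Y x

end LeviCivita

section Submersion

variable {E : Type*} [NormedAddCommGroup E] [NormedSpace ℝ E]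
  {H : Type*} [TopologicalSpace H] (I : ModelWithCorners ℝ E H)
  {M : Type*} [TopologicalSpace M] [ChartedSpace H M]
  [RiemannianBundle (fun x : M ↦ TangentSpace I x)]
  {E' : Type*} [NormedAddCommGroup E'] [NormedSpace ℝ E']
  {H' : Type*} [TopologicalSpace H'] (J : ModelWithCorners ℝ E' H')
  {N : Type*} [TopologicalSpace N] [ChartedSpace H' N]

/-- The vertical space at `x`, i.e. the kernel of the differential of `p`. For a submersion `p`,
this is the tangent space at `x` of the fiber of `p` through `x`. -/
def verticalSpace (p : M → N) (x : M) : Submodule ℝ (TangentSpace I x) :=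
  LinearMap.ker (mfderiv I J p x : TangentSpace I x →ₗ[ℝ] TangentSpace J (p x))

/-- The dimension at `x` of the fiber of the submersion `p` through `x`, that is, the dimension of
its tangent space. -/
def fiberDim (p : M → N) (x : M) : ℕ := finrank ℝ (verticalSpace I J p x)

/-- `p` is a Riemannian submersion: a smooth map whose differential at each point is onto, and
isometric on the orthogonal complement of its kernel (the horizontal space). -/
structure IsRiemannianSubmersion [RiemannianBundle (fun y : N ↦ TangentSpace J y)]
    (p : M → N) : Prop where
  contMDiff : ContMDiff I J ∞ p
  surjective_mfderiv : ∀ x, Function.Surjective (mfderiv I J p x)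
  isometry_horizontal : ∀ x, ∀ u ∈ (verticalSpace I J p x)ᗮ, ∀ v ∈ (verticalSpace I J p x)ᗮ,
    inner ℝ (mfderiv I J p x u) (mfderiv I J p x v) = inner ℝ u v

/-- The fiber of the submersion `p` over `q` is totally geodesic, i.e. its second fundamental form
vanishes: if two local smooth vector fields `V`, `W` on `M` are tangent to the fiber along the
fiber, then so is `∇_V W`. -/
def IsTotallyGeodesicFiber [FiniteDimensional ℝ E] [IsManifold I ∞ M]
    [IsContMDiffRiemannianBundle I ∞ E (fun x : M ↦ TangentSpace I x)] (p : M → N) (q : N) : Prop :=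
  ∀ (U : Set M) (V W : Π x : M, TangentSpace I x), IsOpen U →
    CMDiff[U] ∞ (T% V) → CMDiff[U] ∞ (T% W) →
    (∀ y ∈ U, p y = q → V y ∈ verticalSpace I J p y) →
    (∀ y ∈ U, p y = q → W y ∈ verticalSpace I J p y) →
    ∀ x ∈ U, p x = q → leviCivita I M W x (V x) ∈ verticalSpace I J p x

end Submersion

section Sphere

open Metric

/-- There are `k` smooth tangent vector fields on the unit sphere `S^{n-1}` of `ℝⁿ` that are
linearly independent at each point. A tangent vector field is given by a map to `ℝⁿ` which at each
`x` of the sphere is orthogonal to `x`. -/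
def HasIndependentFields (n k : ℕ) : Prop :=
  ∃ v : Fin k → EuclideanSpace ℝ (Fin n) → EuclideanSpace ℝ (Fin n),
    (∀ i, ContDiffOn ℝ ∞ (v i) (sphere 0 1)) ∧
    (∀ i, ∀ x ∈ sphere (0 : EuclideanSpace ℝ (Fin n)) 1, inner ℝ x (v i x) = 0) ∧
    ∀ x ∈ sphere (0 : EuclideanSpace ℝ (Fin n)) 1, LinearIndependent ℝ (fun i ↦ v i x)

/-- `ρ(n)`, the maximal number of linearly independent vector fields on `S^{n-1}`. -/
def sphereFieldNumber (n : ℕ) : ℕ := sSup {k | HasIndependentFields n k}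

/-- For `n ≥ 1` the maximum in the definition of `ρ(n)` exists. -/
theorem isGreatest_sphereFieldNumber {n : ℕ} (hn : 0 < n) :
    IsGreatest {k | HasIndependentFields n k} (sphereFieldNumber n) := by
  have hb : BddAbove {k | HasIndependentFields n k} := by
    refine ⟨n, ?_⟩
    rintro k ⟨v, -, -, hv⟩
    have h := (hv (EuclideanSpace.single ⟨0, hn⟩ 1) (by simp)).fintype_card_le_finrank
    simpa using h
  have hne : {k | HasIndependentFields n k}.Nonempty :=
    ⟨0, fun i ↦ i.elim0, fun i ↦ i.elim0, fun i ↦ i.elim0, fun _ _ ↦ linearIndependent_empty_type⟩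
  exact ⟨Nat.sSup_mem hne hb, fun k hk ↦ le_csSup hb hk⟩

end Sphere

end RiemSubm

end

noncomputable section

set_option linter.unusedSectionVars false

namespace RiemSubm

/-! ### Vector fields as derivations, computed in a chart -/

section LieBracket

open VectorField ContinuousLinearMap

variable {E : Type*} [NormedAddCommGroup E] [NormedSpace ℝ E] [CompleteSpace E]
  {H : Type*} [TopologicalSpace H] {I : ModelWithCorners ℝ E H} [I.Boundaryless]
  {M : Type*} [TopologicalSpace M] [ChartedSpace H M] [IsManifold I ∞ M]
  {F : Type*} [NormedAddCommGroup F] [NormedSpace ℝ F]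

/-! Fix `x`. For a vector `ξ` at `p x` let `X` be the horizontal lift of a field extending `ξ`, and
for a vertical `v` consider `∇_v X`, which is bilinear in `(v, ξ)`. Three facts make each `v` give a
linear tangent field on the unit sphere of the horizontal space.

Tangency: `|X|²` is pulled back from `N`, hence constant along fibers, so `⟨∇_v X, X⟩ = 0`
(`inner_leviCivita_self`). Horizontality: for vertical `V`, `W`, differentiating `⟨W, X⟩ = 0` gives
`⟨W, ∇_V X⟩ = -⟨∇_V W, X⟩`, which vanishes because the fibers are totally geodesic
(`inner_leviCivita_vertical`). Nondegeneracy: `⟨R(X,V)V, X⟩ = |∇_V X|²`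
(`IsBasicOn.inner_curvature`), so positive curvature forces `∇_v X ≠ 0` whenever `v ≠ 0` and `ξ ≠ 0`
(`oneillMap_ne_zero`).

A basis of the vertical space therefore yields `dim F` fields on the sphere `S^{n-1}`, `n = dim N`.
A linear relation among them at a point would be a nonzero `v` with `∇_v X = 0`, so they are
independent everywhere and `dim F ≤ ρ(n)`.

The curvature computation rests on one fact about brackets: `[X, V]` is vertical for `X` basic and
`V` vertical. It follows from the commutator formula `mvfderiv_apply_mlieBracket`. -/

lemma fderiv_comp_extChartAt_symm {g : M → F} {x : M} {z : E}
    (hz : z ∈ (extChartAt I x).target) (hg : MDiffAt g ((extChartAt I x).symm z)) (u : E) :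
    fderiv ℝ (g ∘ (extChartAt I x).symm) z u
      = mvfderiv I g ((extChartAt I x).symm z)
          (mfderiv 𝓘(ℝ, E) I (extChartAt I x).symm z u) := by
  have hd := mdifferentiableWithinAt_extChartAt_symm (I := I) hz
  rw [I.range_eq_univ, mdifferentiableWithinAt_univ] at hd
  have h := mfderiv_comp z hg hd
  rw [mfderiv_eq_fderiv] at h
  rw [h]
  rfl

/-- Near `x` the function factors through the chart, and the chain rule cancels the chart
differential against its inverse. This inverse is what carries the bracket computed in the chart
back to the manifold. -/
lemma mvfderiv_apply_inverse_mfderiv_extChartAt {g : M → F} {x : M} (hg : MDiffAt g x) (u : E) :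
    mvfderiv I g x ((mfderiv I 𝓘(ℝ, E) (extChartAt I x) x).inverse u)
      = fderiv ℝ (g ∘ (extChartAt I x).symm) (extChartAt I x x) u := by
  have hx : (extChartAt I x).symm (extChartAt I x x) = x := extChartAt_to_inv x
  have he : g =ᶠ[𝓝 x] (g ∘ (extChartAt I x).symm) ∘ extChartAt I x := by
    filter_upwards [extChartAt_source_mem_nhds (I := I) x] with y hy
    exact congrArg g ((extChartAt I x).left_inv hy).symm
  have hs := mdifferentiableWithinAt_extChartAt_symm (I := I) (mem_extChartAt_target (I := I) x)
  rw [I.range_eq_univ, mdifferentiableWithinAt_univ] at hs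
  have hgs : MDifferentiableAt 𝓘(ℝ, E) 𝓘(ℝ, F) (g ∘ (extChartAt I x).symm) (extChartAt I x x) :=
    MDifferentiableAt.comp _ (by rwa [hx]) hs
  have hch : MDiffAt (extChartAt I x) x := mdifferentiableAt_extChartAt (mem_chart_source H x)
  have h := (hgs.hasMFDerivAt.comp x hch.hasMFDerivAt).congr_of_eventuallyEq he
  have hinv := isInvertible_mfderiv_extChartAt (I := I) (mem_extChartAt_source x)
  have h2 : mvfderiv I g x ((mfderiv I 𝓘(ℝ, E) (extChartAt I x) x).inverse u)
      = mfderiv 𝓘(ℝ, E) 𝓘(ℝ, F) (g ∘ (extChartAt I x).symm) (extChartAt I x x)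
        (mfderiv I 𝓘(ℝ, E) (extChartAt I x) x
          ((mfderiv I 𝓘(ℝ, E) (extChartAt I x) x).inverse u)) := by
    rw [mvfderiv, h.mfderiv]
    rfl
  exact h2.trans ((congrArg _ (hinv.self_apply_inverse _)).trans (by rw [mfderiv_eq_fderiv]; rfl))

lemma fderiv_comp_extChartAt_symm_mpullbackWithin {g : M → F} {x : M} {z : E}
    (hz : z ∈ (extChartAt I x).target) (hg : MDiffAt g ((extChartAt I x).symm z))
    (V : Π y : M, TangentSpace I y) :
    fderiv ℝ (g ∘ (extChartAt I x).symm) z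
        (mpullbackWithin 𝓘(ℝ, E) I (extChartAt I x).symm V (Set.range I) z)
      = mvfderiv I g ((extChartAt I x).symm z) (V ((extChartAt I x).symm z)) := by
  have hi := isInvertible_mfderivWithin_extChartAt_symm (I := I) hz
  rw [I.range_eq_univ, mfderivWithin_univ] at hi
  refine (fderiv_comp_extChartAt_symm hz hg _).trans ?_
  rw [mpullbackWithin_apply, I.range_eq_univ, mfderivWithin_univ, hi.self_apply_inverse]

/-- A vector field acts on functions as a derivation, and the Lie bracket acts as the commutator. -/
lemma mvfderiv_apply_mlieBracket {φ : M → F} {X Y : Π y : M, TangentSpace I y} {x : M}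
    (hφ : CMDiffAt ∞ φ x) (hX : CMDiffAt ∞ (T% X) x) (hY : CMDiffAt ∞ (T% Y) x)
    (hφX : MDiffAt (fun y ↦ mvfderiv I φ y (X y)) x)
    (hφY : MDiffAt (fun y ↦ mvfderiv I φ y (Y y)) x) :
    mvfderiv I φ x (mlieBracket I X Y x)
      = mvfderiv I (fun y ↦ mvfderiv I φ y (Y y)) x (X x)
        - mvfderiv I (fun y ↦ mvfderiv I φ y (X y)) x (Y x) := by
  have hx : (extChartAt I x).symm (extChartAt I x x) = x := extChartAt_to_inv x
  have htgt := mem_extChartAt_target (I := I) x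
  have key {g : M → F} (hg : MDiffAt g x) (V : Π y : M, TangentSpace I y) :
      fderiv ℝ (g ∘ (extChartAt I x).symm) (extChartAt I x x)
          (mpullbackWithin 𝓘(ℝ, E) I (extChartAt I x).symm V (Set.range I) (extChartAt I x x))
        = mvfderiv I g x (V x) := by
    have := fderiv_comp_extChartAt_symm_mpullbackWithin htgt (g := g) (by rwa [hx]) V
    rwa [hx] at this
  have hdiff {V : Π y : M, TangentSpace I y} (hV : CMDiffAt ∞ (T% V) x) :
      DifferentiableAt ℝ (mpullbackWithin 𝓘(ℝ, E) I (extChartAt I x).symm V (Set.range I))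
        (extChartAt I x x) := by
    have h := contMDiffWithinAt_mpullbackWithin_extChartAt_symm (n := ∞) (m := 1)
      (s := Set.univ) (hV.of_le (by simp)) uniqueMDiffOn_univ (Set.mem_univ _) (by norm_cast)
    rw [Set.preimage_univ, Set.inter_univ, contMDiffWithinAt_vectorSpace_iff_contDiffWithinAt] at h
    exact (h.differentiableWithinAt one_ne_zero).differentiableAt
      (extChartAt_target_mem_nhds (I := I) x)
  have hev : ∀ᶠ z in 𝓝 (extChartAt I x x), z ∈ (extChartAt I x).target ∧
      MDiffAt φ ((extChartAt I x).symm z) := by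
    have h1 : ∀ᶠ y in 𝓝 x, MDiffAt φ y := by
      have := (contMDiffAt_iff_contMDiffAt_nhds (n := 1) (by simp)).1 (hφ.of_le (by simp))
      filter_upwards [this] with y hy using hy.mdifferentiableAt one_ne_zero
    have h2 := continuousAt_extChartAt_symm (I := I) x
    rw [ContinuousAt, hx] at h2
    filter_upwards [extChartAt_target_mem_nhds (I := I) x, h2.eventually h1] with z hz hz'
      using ⟨hz, hz'⟩
  have hcomp (V : Π y : M, TangentSpace I y) :
      (fun z ↦ fderiv ℝ (φ ∘ (extChartAt I x).symm) z
        (mpullbackWithin 𝓘(ℝ, E) I (extChartAt I x).symm V (Set.range I) z))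
      =ᶠ[𝓝 (extChartAt I x x)] (fun y ↦ mvfderiv I φ y (V y)) ∘ (extChartAt I x).symm := by
    filter_upwards [hev] with z hz
    exact fderiv_comp_extChartAt_symm_mpullbackWithin hz.1 hz.2 V
  have hψ : ContDiffAt ℝ ∞ (φ ∘ (extChartAt I x).symm) (extChartAt I x x) := by
    have := (contMDiffAt_iff.1 hφ).2
    rw [I.range_eq_univ, contDiffWithinAt_univ] at this
    exact this
  rw [← mlieBracketWithin_univ, mlieBracketWithin_apply,
    mvfderiv_apply_inverse_mfderiv_extChartAt (hφ.mdifferentiableAt (by simp)),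
    Set.preimage_univ, Set.univ_inter]
  -- Without boundary the range of the model is the whole space. The claim becomes the commutator
  -- formula for the chart expressions of `φ`, `X` and `Y`.
  have hbr (A B : E → E) : lieBracketWithin ℝ A B (Set.range I) = lieBracket ℝ A B := by
    rw [I.range_eq_univ, lieBracketWithin_univ]
  refine (congrArg (fderiv ℝ (φ ∘ (extChartAt I x).symm) (extChartAt I x x))
    (congrFun (hbr _ _) _)).trans ?_
  refine (fderiv_apply_lieBracket hψ (by simp; norm_cast) (hdiff hY) (hdiff hX)).trans ?_
  rw [(hcomp Y).fderiv_eq, (hcomp X).fderiv_eq]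
  exact congrArg₂ _ (key hφY X) (key hφX Y)

end LieBracket

/-! ### Smoothness of derived fields and of the Levi-Civita connection -/

section Smoothness

open VectorField

variable {E : Type*} [NormedAddCommGroup E] [NormedSpace ℝ E]
  {H : Type*} [TopologicalSpace H] {I : ModelWithCorners ℝ E H}
  {M : Type*} [TopologicalSpace M] [ChartedSpace H M] [IsManifold I ∞ M]
  {E' : Type*} [NormedAddCommGroup E'] [NormedSpace ℝ E']
  {H' : Type*} [TopologicalSpace H'] {J : ModelWithCorners ℝ E' H'}
  {N : Type*} [TopologicalSpace N] [ChartedSpace H' N] [IsManifold J ∞ N]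

/-- The image of a smooth vector field under the differential of a smooth map is smooth,
as a vector field along the map. -/
lemma contMDiffAt_mfderiv_apply {f : M → N} {X : Π y : M, TangentSpace I y} {x : M}
    (hf : CMDiffAt ∞ f x) (hX : CMDiffAt ∞ (T% X) x) :
    ContMDiffAt I J.tangent ∞
      (fun y ↦ (⟨f y, mfderiv I J f y (X y)⟩ : TangentBundle J N)) x := by
  exact ContMDiffAt.clm_apply_of_inCoordinates (b₁ := id) (b₂ := f)
    (ϕ := fun y ↦ mfderiv I J f y) (hf.mfderiv_const (m := ∞) (by simp)) hX hf

lemma contMDiffAt_mvfderiv_apply {F : Type*} [NormedAddCommGroup F] [NormedSpace ℝ F]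
    {f : M → F} {X : Π y : M, TangentSpace I y} {x : M}
    (hf : CMDiffAt ∞ f x) (hX : CMDiffAt ∞ (T% X) x) :
    CMDiffAt ∞ (fun y ↦ mvfderiv I f y (X y)) x := by
  have := contMDiffAt_mfderiv_apply (J := 𝓘(ℝ, F)) hf hX
  rw [contMDiffAt_totalSpace] at this
  convert this.2 using 2
  simp
  rfl

variable (I) in
/-- Extend a tangent vector at `q` to a vector field which is constant in the preferred
trivialization at `q`. Unlike `FiberBundle.extend`, this is linear everywhere. -/
def localExtension (q : M) : TangentSpace I q →ₗ[ℝ] Π y : M, TangentSpace I y :=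
  LinearMap.pi fun y ↦ (trivializationAt E (TangentSpace I : M → Type _) q).symmₗ ℝ y ∘ₗ
    (trivializationAt E (TangentSpace I : M → Type _) q).linearMapAt ℝ q

lemma localExtension_apply_self {q : M} (v : TangentSpace I q) : localExtension I q v q = v :=
  Trivialization.symmₗ_linearMapAt _ (FiberBundle.mem_baseSet_trivializationAt' q) v

lemma exists_isOpen_contMDiffAt_localExtension {q : M} (v : TangentSpace I q) :
    ∃ U : Set M, IsOpen U ∧ q ∈ U ∧ ∀ y ∈ U, CMDiffAt ∞ (T% (localExtension I q v)) y := by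
  let t := trivializationAt E (TangentSpace I : M → Type _) q
  have hq : q ∈ t.baseSet := FiberBundle.mem_baseSet_trivializationAt' q
  obtain ⟨s, hs, h⟩ := FiberBundle.exists_contMDiffOn_extend (k := ∞) I E v
  refine ⟨interior s ∩ t.baseSet, isOpen_interior.inter t.open_baseSet,
    ⟨mem_interior_iff_mem_nhds.2 hs, hq⟩, fun y hy ↦ ?_⟩
  -- On the base set of the trivialization the field agrees with `FiberBundle.extend`, whose
  -- smoothness is known.
  refine (h.contMDiffAt (mem_interior_iff_mem_nhds.1 hy.1)).congr_of_eventuallyEq ?_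
  filter_upwards [t.open_baseSet.mem_nhds hy.2] with z hz
  congr 1
  change t.symmₗ ℝ z (t.linearMapAt ℝ q v) = t.symm z (t ⟨q, v⟩).2
  rw [t.coe_linearMapAt_of_mem hq, t.symmₗ_apply hz]

variable [RiemannianBundle (fun x : M ↦ TangentSpace I x)]
  [FiniteDimensional ℝ E]
  [IsContMDiffRiemannianBundle I ∞ E (fun x : M ↦ TangentSpace I x)]

/-- A vector field whose inner products with all smooth vector fields are smooth is smooth. -/
lemma contMDiffAt_of_inner {X : Π y : M, TangentSpace I y} {x : M}
    (h : ∀ Z : Π y : M, TangentSpace I y, CMDiffAt ∞ (T% Z) x → CMDiffAt ∞ (metricFun I X Z) x) :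
    CMDiffAt ∞ (T% X) x := by
  let b := Module.finBasis ℝ E
  let t := trivializationAt E (TangentSpace I : M → Type _) x
  have hxt : x ∈ t.baseSet := FiberBundle.mem_baseSet_trivializationAt' x
  let s := t.localFrame b
  have hs : IsLocalFrameOn I E ∞ s t.baseSet := t.isLocalFrameOn_localFrame_baseSet I ∞ b
  have hsm (i) : CMDiffAt ∞ (T% (s i)) x := hs.contMDiffAt t.open_baseSet hxt i
  -- `D i j` are the matrix units and `G` is the Gram matrix of a local frame. The frame
  -- coefficients of `X` are `G⁻¹` applied to the inner products of `X` with the frame, and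
  -- inversion of operators is smooth.
  let D (i j : Fin (finrank ℝ E)) : (Fin (finrank ℝ E) → ℝ) →L[ℝ] (Fin (finrank ℝ E) → ℝ) :=
    (ContinuousLinearMap.proj (R := ℝ) (φ := fun _ : Fin (finrank ℝ E) ↦ ℝ) i).smulRight
      (Pi.single j (1 : ℝ))
  let G (y : M) : (Fin (finrank ℝ E) → ℝ) →L[ℝ] (Fin (finrank ℝ E) → ℝ) :=
    ∑ i, ∑ j, metricFun I (s i) (s j) y • D i j
  have hG (y : M) (c : Fin (finrank ℝ E) → ℝ) (j : Fin (finrank ℝ E)) :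
      G y c j = inner ℝ (∑ i, c i • s i y) (s j y) := by
    simp [G, D, metricFun, Finset.sum_apply, sum_inner, inner_smul_left, Pi.single_apply, mul_comm]
  have hGsm : ContMDiffAt I 𝓘(ℝ, (Fin (finrank ℝ E) → ℝ) →L[ℝ] (Fin (finrank ℝ E) → ℝ)) ∞ G x := by
    refine ContMDiffAt.sum fun i _ ↦ ContMDiffAt.sum fun j _ ↦ ?_
    have : CMDiffAt ∞ (metricFun I (s i) (s j)) x := ContMDiffAt.inner_bundle (IB := I) (F := E)
      (E := fun x : M ↦ TangentSpace I x) (b := id) (hsm i) (hsm j)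
    exact this.smul contMDiffAt_const
  have hGinv (y : M) (hy : y ∈ t.baseSet) : (G y).IsInvertible := by
    -- A kernel vector of the Gram matrix gives a combination of the frame orthogonal to itself.
    have hinj : Function.Injective (G y) := by
      refine (injective_iff_map_eq_zero _).2 fun c hc ↦ ?_
      have h0 (j) : inner ℝ (∑ i, c i • s i y) (s j y) = 0 := by rw [← hG, hc, Pi.zero_apply]
      have h1 : inner ℝ (∑ i, c i • s i y) (∑ j, c j • s j y) = 0 := by
        rw [inner_sum]
        exact Finset.sum_eq_zero fun j _ ↦ by rw [inner_smul_right, h0, mul_zero]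
      have h2 := Fintype.linearIndependent_iff.1 (hs.linearIndependent hy) c
        (inner_self_eq_zero.1 h1)
      exact funext h2
    exact ⟨(LinearEquiv.ofInjectiveEndo (G y : (Fin (finrank ℝ E) → ℝ) →ₗ[ℝ] _)
      hinj).toContinuousLinearEquiv, by ext1 c; rfl⟩
  let d (y : M) : Fin (finrank ℝ E) → ℝ := fun j ↦ inner ℝ (X y) (s j y)
  have hd : ContMDiffAt I 𝓘(ℝ, Fin (finrank ℝ E) → ℝ) ∞ d x :=
    contMDiffAt_pi_space.2 fun j ↦ h (s j) (hsm j)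
  have hinv : ContMDiffAt I 𝓘(ℝ, Fin (finrank ℝ E) → ℝ) ∞ (fun y ↦ (G y).inverse (d y)) x := by
    refine ContMDiffAt.clm_apply ?_ hd
    exact (hGinv x hxt).contDiffAt_map_inverse.contMDiffAt.comp x hGsm
  refine hs.contMDiffAt_of_coeff (fun i ↦ ?_) (t.open_baseSet.mem_nhds hxt)
  refine (contMDiffAt_pi_space.1 hinv i).congr_of_eventuallyEq ?_
  filter_upwards [t.open_baseSet.mem_nhds hxt] with y hy
  have hGd : G y (fun i ↦ hs.coeff i y (X y)) = d y := by
    funext j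
    rw [hG, ← hs.coeff_sum_eq X hy]
  rw [← hGd, (hGinv y hy).inverse_apply_self]
  rfl

/-- The Levi-Civita connection maps smooth vector fields to smooth ones. -/
lemma contMDiffAt_leviCivita {X Y : Π y : M, TangentSpace I y} {x : M}
    (hX : CMDiffAt ∞ (T% X) x) (hY : CMDiffAt ∞ (T% Y) x) :
    CMDiffAt ∞ (T% (fun y ↦ leviCivita I M Y y (X y))) x := by
  have hinner {A B : Π y : M, TangentSpace I y} (hA : CMDiffAt ∞ (T% A) x)
      (hB : CMDiffAt ∞ (T% B) x) : CMDiffAt ∞ (metricFun I A B) x :=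
    ContMDiffAt.inner_bundle (IB := I) (F := E) (E := fun x : M ↦ TangentSpace I x) (b := id) hA hB
  have : IsManifold I (minSmoothness ℝ 2) M := .of_le (n := ∞) (by simp; norm_cast)
  have : IsManifold I (∞ + 1) M := .of_le (n := ∞) (by simp)
  have hbr {A B : Π y : M, TangentSpace I y} (hA : CMDiffAt ∞ (T% A) x)
      (hB : CMDiffAt ∞ (T% B) x) : CMDiffAt ∞ (T% (mlieBracket I A B)) x := 
    ContMDiffAt.mlieBracket_vectorField (m := ⊤) (n := ⊤) hA hB (by simp)
  have hev {A : Π y : M, TangentSpace I y} (hA : CMDiffAt ∞ (T% A) x) :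
      ∀ᶠ y in 𝓝 x, MDiffAt (T% A) y := by
    filter_upwards [(contMDiffAt_iff_contMDiffAt_nhds (n := 1) (by simp)).1 (hA.of_le (by simp))]
      with y hy using hy.mdifferentiableAt one_ne_zero
  -- By Koszul's formula the inner products of `∇_X Y` with smooth fields are built from derivatives
  -- and brackets of smooth data.
  refine contMDiffAt_of_inner fun Z hZ ↦ ?_
  have : CMDiffAt ∞ (koszul I X Y Z) x := by
    have h1 := contMDiffAt_mvfderiv_apply (hinner hY hZ) hX
    have h2 := contMDiffAt_mvfderiv_apply (hinner hX hZ) hY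
    have h3 := contMDiffAt_mvfderiv_apply (hinner hX hY) hZ
    have h4 := hinner (hbr hX hY) hZ
    have h5 := hinner (hbr hX hZ) hY
    have h6 := hinner (hbr hY hZ) hX
    exact (((((h1.add h2).sub h3).add h4).sub h5).sub h6).div_const 2
  refine this.congr_of_eventuallyEq ?_
  filter_upwards [hev hX, hev hY, hev hZ] with y h1 h2 h3
  exact inner_leviCivitaFun h1 h2 h3

end Smoothness

/-! ### Basic and vertical fields, and O'Neill's curvature formula -/

section ONeill

open VectorField

variable {E : Type*} [NormedAddCommGroup E] [NormedSpace ℝ E] [FiniteDimensional ℝ E]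
  {H : Type*} [TopologicalSpace H] {I : ModelWithCorners ℝ E H} [I.Boundaryless]
  {M : Type*} [TopologicalSpace M] [ChartedSpace H M] [IsManifold I ∞ M]
  {E' : Type*} [NormedAddCommGroup E'] [NormedSpace ℝ E']
  {H' : Type*} [TopologicalSpace H'] {J : ModelWithCorners ℝ E' H'}
  {N : Type*} [TopologicalSpace N] [ChartedSpace H' N] [IsManifold J ∞ N]

lemma mvfderiv_congr {F : Type*} [NormedAddCommGroup F] [NormedSpace ℝ F] {f g : M → F} {x : M}
    (h : f =ᶠ[𝓝 x] g) : mvfderiv I f x = mvfderiv I g x := by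
  ext v
  change mfderiv I 𝓘(ℝ, F) f x v = mfderiv I 𝓘(ℝ, F) g x v
  rw [h.mfderiv_eq]
  rfl

lemma mvfderiv_comp_map_apply {F : Type*} [NormedAddCommGroup F] [NormedSpace ℝ F] {g : N → F}
    {f : M → N} {x : M} (hg : MDiffAt g (f x)) (hf : MDiffAt f x) (v : TangentSpace I x) :
    mvfderiv I (g ∘ f) x v = mvfderiv J g (f x) (mfderiv I J f x v) := by
  have h := mfderiv_comp x hg hf
  change mfderiv I 𝓘(ℝ, F) (g ∘ f) x v = mfderiv J 𝓘(ℝ, F) g (f x) (mfderiv I J f x v)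
  rw [h]
  rfl

/-- The bracket of a vector field that is `p`-related to a vector field with one that is
`p`-related to zero is `p`-related to zero. -/
lemma mfderiv_mlieBracket_eq_zero {p : M → N} {X V : Π y : M, TangentSpace I y}
    {η : Π q : N, TangentSpace J q} {x : M} (hp : CMDiffAt ∞ p x)
    (hX : CMDiffAt ∞ (T% X) x) (hV : CMDiffAt ∞ (T% V) x) (hη : CMDiffAt ∞ (T% η) (p x))
    (hXη : ∀ᶠ y in 𝓝 x, mfderiv I J p y (X y) = η (p y))
    (hV0 : ∀ᶠ y in 𝓝 x, mfderiv I J p y (V y) = 0) :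
    mfderiv I J p x (mlieBracket I X V x) = 0 := by
  -- The chart `ψ` serves as a vector-valued test function. `V(ψ ∘ p) = 0`, and `X(ψ ∘ p)` is the
  -- pullback of `ηψ`, which `V` also kills; so `[X, V]` annihilates `ψ ∘ p`.
  let ψ : N → E' := extChartAt J (p x)
  have hψ : CMDiffAt ∞ ψ (p x) := contMDiffAt_extChartAt
  have hpd : ∀ᶠ y in 𝓝 x, MDiffAt p y := by
    filter_upwards [(contMDiffAt_iff_contMDiffAt_nhds (n := 1) (by simp)).1 (hp.of_le (by simp))]
      with y hy using hy.mdifferentiableAt one_ne_zero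
  have hψd : ∀ᶠ y in 𝓝 x, MDiffAt ψ (p y) := by
    filter_upwards [hp.continuousAt.eventually
      ((contMDiffAt_iff_contMDiffAt_nhds (n := 1) (by simp)).1 (hψ.of_le (by simp)))]
      with y hy using hy.mdifferentiableAt one_ne_zero
  have hφ : CMDiffAt ∞ (ψ ∘ p) x := hψ.comp x hp
  have hg : CMDiffAt ∞ (fun q ↦ mvfderiv J ψ q (η q)) (p x) := contMDiffAt_mvfderiv_apply hψ hη
  have hφX : (fun y ↦ mvfderiv I (ψ ∘ p) y (X y)) =ᶠ[𝓝 x] (fun q ↦ mvfderiv J ψ q (η q)) ∘ p := by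
    filter_upwards [hpd, hψd, hXη] with y h1 h2 h3
    rw [mvfderiv_comp_map_apply h2 h1, h3]
    rfl
  have hφV : (fun y ↦ mvfderiv I (ψ ∘ p) y (V y)) =ᶠ[𝓝 x] fun _ ↦ 0 := by
    filter_upwards [hpd, hψd, hV0] with y h1 h2 h3
    rw [mvfderiv_comp_map_apply h2 h1, h3, map_zero]
  have h := mvfderiv_apply_mlieBracket hφ hX hV
    ((contMDiffAt_mvfderiv_apply hφ hX).mdifferentiableAt (by simp))
    ((contMDiffAt_mvfderiv_apply hφ hV).mdifferentiableAt (by simp))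
  rw [mvfderiv_congr hφV, mvfderiv_congr hφX, mvfderiv_comp_map_apply
    (hg.mdifferentiableAt (by simp)) hpd.self_of_nhds, hV0.self_of_nhds, map_zero, mvfderiv_const,
    mvfderiv_comp_map_apply hψd.self_of_nhds hpd.self_of_nhds, zero_apply, sub_zero] at h
  -- The differential of a chart is injective, so `ψ` detects the projected bracket.
  have hi : Function.Injective (mfderiv J 𝓘(ℝ, E') ψ (p x)) :=
    (isInvertible_mfderiv_extChartAt (mem_extChartAt_source (I := J) (p x))).injective
  apply hi
  rw [map_zero]
  exact h

variable [RiemannianBundle (fun x : M ↦ TangentSpace I x)]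
  [IsContMDiffRiemannianBundle I ∞ E (fun x : M ↦ TangentSpace I x)]
  [RiemannianBundle (fun x : N ↦ TangentSpace J x)]
  [IsContMDiffRiemannianBundle J ∞ E' (fun x : N ↦ TangentSpace J x)]

variable (J) in
/-- `V` is a smooth vector field on `U` tangent to the fibers of `p`. -/
structure IsVerticalOn (p : M → N) (V : Π y : M, TangentSpace I y) (U : Set M) : Prop where
  contMDiffAt : ∀ y ∈ U, CMDiffAt ∞ (T% V) y
  mem : ∀ y ∈ U, V y ∈ verticalSpace I J p y

/-- `X` is a smooth horizontal vector field on `U` that is `p`-related to the smooth vector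
field `η`. -/
structure IsBasicOn (p : M → N) (X : Π y : M, TangentSpace I y) (η : Π q : N, TangentSpace J q)
    (U : Set M) : Prop where
  contMDiffAt : ∀ y ∈ U, CMDiffAt ∞ (T% X) y
  mem : ∀ y ∈ U, X y ∈ (verticalSpace I J p y)ᗮ
  contMDiffAt_base : ∀ y ∈ U, CMDiffAt ∞ (T% η) (p y)
  related : ∀ y ∈ U, mfderiv I J p y (X y) = η (p y)

variable {p : M → N} {X V W : Π y : M, TangentSpace I y} {η : Π q : N, TangentSpace J q}
  {U : Set M}

lemma IsVerticalOn.mdifferentiableAt (hV : IsVerticalOn J p V U) {y : M} (hy : y ∈ U) :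
    MDiffAt (T% V) y := (hV.contMDiffAt y hy).mdifferentiableAt (by simp)

lemma IsBasicOn.mdifferentiableAt (hX : IsBasicOn p X η U) {y : M} (hy : y ∈ U) :
    MDiffAt (T% X) y := (hX.contMDiffAt y hy).mdifferentiableAt (by simp)

lemma IsBasicOn.inner_vertical (hX : IsBasicOn p X η U) {y : M} (hy : y ∈ U)
    {v : TangentSpace I y} (hv : v ∈ verticalSpace I J p y) : inner ℝ v (X y) = 0 :=
  hX.mem y hy v hv

/-- The bracket of a basic and a vertical field is vertical. -/
lemma IsBasicOn.isVerticalOn_mlieBracket (hX : IsBasicOn p X η U) (hV : IsVerticalOn J p V U)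
    (hU : IsOpen U) (hp : ContMDiff I J ∞ p) : IsVerticalOn J p (mlieBracket I X V) U where
  contMDiffAt y hy := by
    have : IsManifold I (minSmoothness ℝ 2) M := .of_le (n := ∞) (by simp; norm_cast)
    have : IsManifold I (∞ + 1) M := .of_le (n := ∞) (by simp)
    exact ContMDiffAt.mlieBracket_vectorField (m := ⊤) (n := ⊤) (hX.contMDiffAt y hy)
      (hV.contMDiffAt y hy) (by simp)
  mem y hy := mfderiv_mlieBracket_eq_zero (hp y) (hX.contMDiffAt y hy) (hV.contMDiffAt y hy)
    (hX.contMDiffAt_base y hy) (Filter.eventually_of_mem (hU.mem_nhds hy) hX.related)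
    (Filter.eventually_of_mem (hU.mem_nhds hy) hV.mem)

/-- Covariant derivatives of vertical fields in vertical directions are vertical if the fibers are
totally geodesic. -/
lemma IsVerticalOn.leviCivita_vertical (hV : IsVerticalOn J p V U) (hW : IsVerticalOn J p W U)
    (hU : IsOpen U) (hF : ∀ q, IsTotallyGeodesicFiber I J p q) :
    IsVerticalOn J p (fun y ↦ leviCivita I M W y (V y)) U where
  contMDiffAt y hy := contMDiffAt_leviCivita (hV.contMDiffAt y hy) (hW.contMDiffAt y hy)
  mem y hy := hF (p y) U V W hU (fun z hz ↦ (hV.contMDiffAt z hz).contMDiffWithinAt)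
    (fun z hz ↦ (hW.contMDiffAt z hz).contMDiffWithinAt) (fun z hz _ ↦ hV.mem z hz)
    (fun z hz _ ↦ hW.mem z hz) y hy rfl

/-- The squared length of a basic field is constant along the fibers. -/
lemma IsBasicOn.inner_leviCivita_self (hX : IsBasicOn p X η U) (hU : IsOpen U)
    (hp : IsRiemannianSubmersion I J p) (hV : IsVerticalOn J p V U) {y : M} (hy : y ∈ U) :
    inner ℝ (leviCivita I M X y (V y)) (X y) = 0 := by
  have h := leviCivita_metric (hV.mdifferentiableAt hy) (hX.mdifferentiableAt hy)
    (hX.mdifferentiableAt hy)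
  -- Since `dp` is isometric on horizontal vectors, `|X|²` descends to `N`, and its derivative along
  -- a vertical vector vanishes.
  have he : metricFun I X X =ᶠ[𝓝 y] metricFun J η η ∘ p := by
    filter_upwards [hU.mem_nhds hy] with z hz
    have := hp.isometry_horizontal z _ (hX.mem z hz) _ (hX.mem z hz)
    rw [hX.related z hz] at this
    exact this.symm
  have hηd : MDiffAt (T% η) (p y) := (hX.contMDiffAt_base y hy).mdifferentiableAt (by simp)
  have hm : MDiffAt (metricFun J η η) (p y) := MDifferentiableAt.inner_bundle (IB := J) (F := E')
    (E := fun x : N ↦ TangentSpace J x) (b := id) hηd hηd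
  rw [mvfderiv_congr he, mvfderiv_comp_map_apply hm ((hp.contMDiff y).mdifferentiableAt (by simp)),
    show mfderiv I J p y (V y) = 0 from hV.mem y hy, map_zero, real_inner_comm (X y)] at h
  rw [real_inner_comm]
  linarith

/-- Covariant derivatives of a basic field in vertical directions are horizontal. -/
lemma IsBasicOn.inner_leviCivita_vertical (hX : IsBasicOn p X η U) (hU : IsOpen U)
    (hF : ∀ q, IsTotallyGeodesicFiber I J p q) (hV : IsVerticalOn J p V U)
    (hW : IsVerticalOn J p W U) {y : M} (hy : y ∈ U) :
    inner ℝ (W y) (leviCivita I M X y (V y)) = 0 := by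
  have h := leviCivita_metric (hV.mdifferentiableAt hy) (hW.mdifferentiableAt hy)
    (hX.mdifferentiableAt hy)
  have he : metricFun I W X =ᶠ[𝓝 y] fun _ ↦ 0 := by
    filter_upwards [hU.mem_nhds hy] with z hz using hX.inner_vertical hz (hW.mem z hz)
  rw [mvfderiv_congr he, mvfderiv_const,
    hX.inner_vertical hy ((hV.leviCivita_vertical hW hU hF).mem y hy)] at h
  simpa using h.symm

/-- This is torsion-freeness. As the bracket is vertical, `∇_X V` and `∇_V X` have the same
horizontal part. -/
lemma IsBasicOn.leviCivita_eq_add (hX : IsBasicOn p X η U) (hV : IsVerticalOn J p V U) {y : M}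
    (hy : y ∈ U) : leviCivita I M V y (X y)
      = leviCivita I M X y (V y) + mlieBracket I X V y := by
  rw [← (CovariantDerivative.torsion_eq_zero_iff (leviCivita I M)).1 leviCivita_torsion
    (hX.mdifferentiableAt hy) (hV.mdifferentiableAt hy)]
  abel

/-- The covariant derivative of a vertical field along a basic field is orthogonal to the latter. -/
lemma IsBasicOn.inner_leviCivita_basic (hX : IsBasicOn p X η U) (hU : IsOpen U)
    (hp : IsRiemannianSubmersion I J p) (hV : IsVerticalOn J p V U) {y : M} (hy : y ∈ U) :
    inner ℝ (leviCivita I M V y (X y)) (X y) = 0 := by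
  rw [hX.leviCivita_eq_add hV hy, inner_add_left, hX.inner_leviCivita_self hU hp hV hy,
    hX.inner_vertical hy ((hX.isVerticalOn_mlieBracket hV hU hp.contMDiff).mem y hy), add_zero]

/-- O'Neill's formula for curvatures of planes spanned by a basic and a vertical field when the
fibers are totally geodesic: `⟨R(X,V)V, X⟩ = |∇_V X|²`. -/
theorem IsBasicOn.inner_curvature (hX : IsBasicOn p X η U) (hU : IsOpen U)
    (hp : IsRiemannianSubmersion I J p) (hF : ∀ q, IsTotallyGeodesicFiber I J p q)
    (hV : IsVerticalOn J p V U) {x : M} (hx : x ∈ U) :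
    inner ℝ (curvature I X V V x) (X x)
      = inner ℝ (leviCivita I M X x (V x)) (leviCivita I M X x (V x)) := by
  have hbr := hX.isVerticalOn_mlieBracket hV hU hp.contMDiff
  have hXV := contMDiffAt_leviCivita (hX.contMDiffAt x hx) (hV.contMDiffAt x hx)
  have h := leviCivita_metric (hV.mdifferentiableAt hx) (hXV.mdifferentiableAt (by simp))
    (hX.mdifferentiableAt hx)
  -- Differentiating `⟨∇_X V, X⟩ = 0` along `V` gives `⟨∇_V ∇_X V, X⟩ = -⟨∇_X V, ∇_V X⟩`. The right
  -- side is `-|∇_V X|²`, since `[X, V]` is vertical and `∇_V X` is orthogonal to vertical fields.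
  have he : metricFun I (fun y ↦ leviCivita I M V y (X y)) X =ᶠ[𝓝 x] fun _ ↦ 0 := by
    filter_upwards [hU.mem_nhds hx] with y hy using hX.inner_leviCivita_basic hU hp hV hy
  rw [mvfderiv_congr he, mvfderiv_const, zero_apply, hX.leviCivita_eq_add hV hx, inner_add_left,
    hX.inner_leviCivita_vertical hU hF hV hbr hx, add_zero] at h
  -- The other two curvature terms drop out: `∇_V V` is vertical, so its derivative along `X` is
  -- orthogonal to `X`, and `∇_[X,V] V` is itself vertical.
  rw [curvature, inner_sub_left, inner_sub_left,
    hX.inner_leviCivita_basic hU hp (hV.leviCivita_vertical hV hU hF) hx,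
    hX.inner_vertical hx ((hbr.leviCivita_vertical hV hU hF).mem x hx)]
  linarith

end ONeill

/-! ### Linear algebra of coisometries -/

section CoisometryAdjoint

variable {T S : Type*} [NormedAddCommGroup T] [InnerProductSpace ℝ T] [FiniteDimensional ℝ T]
  [NormedAddCommGroup S] [InnerProductSpace ℝ S] [FiniteDimensional ℝ S]

lemma adjoint_mem_orthogonal_ker (A : T →ₗ[ℝ] S) (w : S) :
    LinearMap.adjoint A w ∈ (LinearMap.ker A)ᗮ := fun u hu ↦ by
  rw [LinearMap.adjoint_inner_right, LinearMap.mem_ker.1 hu, inner_zero_left]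

/-- The adjoint of a surjective linear map that is isometric on the orthogonal complement of its
kernel is a right inverse. -/
lemma apply_adjoint_of_isometry_orthogonal_ker {A : T →ₗ[ℝ] S} (hA : Function.Surjective A)
    (hiso : ∀ u ∈ (LinearMap.ker A)ᗮ, ∀ v ∈ (LinearMap.ker A)ᗮ, inner ℝ (A u) (A v) = inner ℝ u v)
    (w : S) : A (LinearMap.adjoint A w) = w := by
  refine ext_inner_right ℝ fun z ↦ ?_
  -- Test against `A u` and keep only the component `b` of `u` orthogonal to the kernel: isometry
  -- and adjunction give `⟨A A* w, A b⟩ = ⟨A* w, b⟩ = ⟨w, A b⟩`.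
  obtain ⟨u, rfl⟩ := hA z
  obtain ⟨a, ha, b, hb, rfl⟩ := (LinearMap.ker A).exists_add_mem_mem_orthogonal u
  rw [map_add, LinearMap.mem_ker.1 ha, zero_add,
    hiso _ (adjoint_mem_orthogonal_ker A w) _ hb, LinearMap.adjoint_inner_left]

end CoisometryAdjoint

/-! ### Horizontal lifts and vertical extensions -/

section Lift

variable {E : Type*} [NormedAddCommGroup E] [NormedSpace ℝ E] [FiniteDimensional ℝ E]
  {H : Type*} [TopologicalSpace H] {I : ModelWithCorners ℝ E H} [I.Boundaryless]
  {M : Type*} [TopologicalSpace M] [ChartedSpace H M] [IsManifold I ∞ M]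
  {E' : Type*} [NormedAddCommGroup E'] [NormedSpace ℝ E'] [FiniteDimensional ℝ E']
  {H' : Type*} [TopologicalSpace H'] {J : ModelWithCorners ℝ E' H'}
  {N : Type*} [TopologicalSpace N] [ChartedSpace H' N] [IsManifold J ∞ N]
  [RiemannianBundle (fun x : M ↦ TangentSpace I x)]
  [IsContMDiffRiemannianBundle I ∞ E (fun x : M ↦ TangentSpace I x)]
  [RiemannianBundle (fun x : N ↦ TangentSpace J x)]
  [IsContMDiffRiemannianBundle J ∞ E' (fun x : N ↦ TangentSpace J x)]

variable (I J) in
/-- The adjoint of the differential of `p` at `x`; for a Riemannian submersion, this is the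
horizontal lift of tangent vectors. -/
def horizontalLift (p : M → N) (x : M) : TangentSpace J (p x) →ₗ[ℝ] TangentSpace I x :=
  LinearMap.adjoint (mfderiv I J p x : TangentSpace I x →ₗ[ℝ] TangentSpace J (p x))

variable {p : M → N}

lemma horizontalLift_mem_orthogonal (x : M) (w : TangentSpace J (p x)) :
    horizontalLift I J p x w ∈ (verticalSpace I J p x)ᗮ :=
  adjoint_mem_orthogonal_ker _ w

lemma inner_horizontalLift (x : M) (w : TangentSpace J (p x)) (v : TangentSpace I x) :
    inner ℝ (horizontalLift I J p x w) v = inner ℝ w (mfderiv I J p x v) :=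
  LinearMap.adjoint_inner_left _ _ _

lemma IsRiemannianSubmersion.mfderiv_horizontalLift (hp : IsRiemannianSubmersion I J p) (x : M)
    (w : TangentSpace J (p x)) : mfderiv I J p x (horizontalLift I J p x w) = w :=
  apply_adjoint_of_isometry_orthogonal_ker
    (A := (mfderiv I J p x : TangentSpace I x →ₗ[ℝ] TangentSpace J (p x)))
    (hp.surjective_mfderiv x) (hp.isometry_horizontal x) w

/-- The horizontal lift of a vector field that is smooth along `p` is smooth. -/
lemma contMDiffAt_horizontalLift {w : Π y : M, TangentSpace J (p y)} {x : M}
    (hp : CMDiffAt ∞ p x)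
    (hw : ContMDiffAt I J.tangent ∞ (fun y ↦ (⟨p y, w y⟩ : TangentBundle J N)) x) :
    CMDiffAt ∞ (T% (fun y ↦ horizontalLift I J p y (w y))) x := by
  refine contMDiffAt_of_inner fun Z hZ ↦ ?_
  have h : CMDiffAt ∞ (fun y ↦ inner ℝ (w y) (mfderiv I J p y (Z y))) x :=
    ContMDiffAt.inner_bundle (IB := J) (F := E') (E := fun q : N ↦ TangentSpace J q) (b := p) hw
      (contMDiffAt_mfderiv_apply hp hZ)
  refine h.congr_of_eventuallyEq (Filter.Eventually.of_forall fun y ↦ ?_)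
  exact inner_horizontalLift y _ _

/-- The horizontal lift of a smooth vector field is basic. -/
lemma isBasicOn_horizontalLift (hp : IsRiemannianSubmersion I J p) {η : Π q : N, TangentSpace J q}
    {U : Set M} (hη : ∀ y ∈ U, CMDiffAt ∞ (T% η) (p y)) :
    IsBasicOn p (fun y ↦ horizontalLift I J p y (η (p y))) η U where
  contMDiffAt y hy := contMDiffAt_horizontalLift (hp.contMDiff y)
    ((hη y hy).comp y (hp.contMDiff y))
  mem y _ := horizontalLift_mem_orthogonal y _
  contMDiffAt_base := hη
  related y _ := hp.mfderiv_horizontalLift y _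

/-- Every vertical vector extends to a smooth vertical vector field on a neighborhood. -/
lemma IsRiemannianSubmersion.exists_isVerticalOn (hp : IsRiemannianSubmersion I J p) {x : M}
    {v : TangentSpace I x} (hv : v ∈ verticalSpace I J p x) :
    ∃ (U : Set M) (V : Π y : M, TangentSpace I y), IsOpen U ∧ x ∈ U ∧ IsVerticalOn J p V U ∧
      V x = v := by
  obtain ⟨U, hU, hxU, hZ⟩ := exists_isOpen_contMDiffAt_localExtension v
  let Z : Π y : M, TangentSpace I y := localExtension I x v
  have hZx : Z x = v := localExtension_apply_self v
  -- Extend `v` arbitrarily and subtract the horizontal part; at `x` nothing is subtracted because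
  -- `v` is vertical.
  refine ⟨U, Z - fun y ↦ horizontalLift I J p y (mfderiv I J p y (Z y)), hU, hxU, ⟨?_, ?_⟩, ?_⟩
  · intro y hy
    exact (hZ y hy).sub_section (contMDiffAt_horizontalLift (hp.contMDiff y)
      (contMDiffAt_mfderiv_apply (hp.contMDiff y) (hZ y hy)))
  · intro y _
    change mfderiv I J p y (Z y - _) = 0
    rw [map_sub, hp.mfderiv_horizontalLift, sub_self]
  · rw [Pi.sub_apply, hZx, show mfderiv I J p x v = 0 from hv, map_zero, sub_zero]

end Lift

/-! ### Fatness and the vector fields on the sphere -/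

section FatBundle

variable {E : Type*} [NormedAddCommGroup E] [NormedSpace ℝ E] [FiniteDimensional ℝ E]
  {H : Type*} [TopologicalSpace H] {I : ModelWithCorners ℝ E H} [I.Boundaryless]
  {M : Type*} [TopologicalSpace M] [ChartedSpace H M] [IsManifold I ∞ M]
  {E' : Type*} [NormedAddCommGroup E'] [NormedSpace ℝ E'] [FiniteDimensional ℝ E']
  {H' : Type*} [TopologicalSpace H'] {J : ModelWithCorners ℝ E' H'}
  {N : Type*} [TopologicalSpace N] [ChartedSpace H' N] [IsManifold J ∞ N]
  [RiemannianBundle (fun x : M ↦ TangentSpace I x)]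
  [IsContMDiffRiemannianBundle I ∞ E (fun x : M ↦ TangentSpace I x)]
  [RiemannianBundle (fun x : N ↦ TangentSpace J x)]
  [IsContMDiffRiemannianBundle J ∞ E' (fun x : N ↦ TangentSpace J x)]
  {p : M → N} {x : M}

variable (I J) in
/-- A basic vector field near `x` with prescribed projection at `x`. -/
def basicField (p : M → N) (x : M) (ξ : TangentSpace J (p x)) : Π y : M, TangentSpace I y :=
  fun y ↦ horizontalLift I J p y (localExtension J (p x) ξ (p y))

lemma basicField_apply_self (ξ : TangentSpace J (p x)) :
    basicField I J p x ξ x = horizontalLift I J p x ξ := by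
  rw [basicField, localExtension_apply_self]

lemma exists_isBasicOn_basicField (hp : IsRiemannianSubmersion I J p) (ξ : TangentSpace J (p x)) :
    ∃ U : Set M, IsOpen U ∧ x ∈ U ∧
      IsBasicOn p (basicField I J p x ξ) (localExtension J (p x) ξ) U := by
  obtain ⟨U, hU, hxU, h⟩ := exists_isOpen_contMDiffAt_localExtension ξ
  exact ⟨p ⁻¹' U, hU.preimage hp.contMDiff.continuous, hxU,
    isBasicOn_horizontalLift hp fun y hy ↦ h _ hy⟩

lemma IsBasicOn.mono {X : Π y : M, TangentSpace I y} {η : Π q : N, TangentSpace J q} {U U' : Set M}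
    (h : IsBasicOn p X η U) (hU : U' ⊆ U) : IsBasicOn p X η U' where
  contMDiffAt y hy := h.contMDiffAt y (hU hy)
  mem y hy := h.mem y (hU hy)
  contMDiffAt_base y hy := h.contMDiffAt_base y (hU hy)
  related y hy := h.related y (hU hy)

lemma IsVerticalOn.mono {V : Π y : M, TangentSpace I y} {U U' : Set M}
    (h : IsVerticalOn J p V U) (hU : U' ⊆ U) : IsVerticalOn J p V U' where
  contMDiffAt y hy := h.contMDiffAt y (hU hy)
  mem y hy := h.mem y (hU hy)

/-- The linear map `ξ ↦ (v ↦ ∇_v X)`, where `X` is the basic field with projection `ξ` at `x`.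
For vertical `v`, this is the O'Neill tensor if the fibers are totally geodesic. -/
def IsRiemannianSubmersion.oneillMap (hp : IsRiemannianSubmersion I J p) (x : M) :
    TangentSpace J (p x) →ₗ[ℝ] TangentSpace I x →L[ℝ] TangentSpace I x :=
  have hd (ξ : TangentSpace J (p x)) : MDiffAt (T% (basicField I J p x ξ)) x := by
    obtain ⟨U, -, hx, h⟩ := exists_isBasicOn_basicField hp ξ
    exact h.mdifferentiableAt hx
  { toFun ξ := leviCivita I M (basicField I J p x ξ) x
    -- Local extension and horizontal lift are linear at every point, so the basic field as a whole
    -- is linear in `ξ`, which lets the connection's additivity apply.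
    map_add' ξ ζ := by
      rw [← (leviCivita I M).isCovariantDerivativeOnUniv.add (hd ξ) (hd ζ)]
      congr 1
      funext y
      simp [basicField]
    map_smul' c ξ := by
      rw [RingHom.id_apply, ← (leviCivita I M).isCovariantDerivativeOnUniv.smul_const c (hd ξ)]
      congr 1
      funext y
      simp [basicField] }

lemma IsRiemannianSubmersion.exists_basic_vertical (hp : IsRiemannianSubmersion I J p)
    (ξ : TangentSpace J (p x)) {v : TangentSpace I x} (hv : v ∈ verticalSpace I J p x) :
    ∃ (U : Set M) (V : Π y : M, TangentSpace I y), IsOpen U ∧ x ∈ U ∧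
      IsBasicOn p (basicField I J p x ξ) (localExtension J (p x) ξ) U ∧ IsVerticalOn J p V U ∧
      V x = v := by
  obtain ⟨U₁, h₁, hx₁, hX⟩ := exists_isBasicOn_basicField hp ξ
  obtain ⟨U₂, V, h₂, hx₂, hV, hVx⟩ := hp.exists_isVerticalOn hv
  exact ⟨U₁ ∩ U₂, V, h₁.inter h₂, ⟨hx₁, hx₂⟩, hX.mono Set.inter_subset_left,
    hV.mono Set.inter_subset_right, hVx⟩

/-- Constancy of `|X|²` along fibers, moved to `N` by adjunction. This makes the fields on the
sphere tangent. -/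
lemma IsRiemannianSubmersion.inner_oneillMap_self (hp : IsRiemannianSubmersion I J p)
    (ξ : TangentSpace J (p x)) {v : TangentSpace I x} (hv : v ∈ verticalSpace I J p x) :
    inner ℝ ξ (mfderiv I J p x (hp.oneillMap x ξ v)) = 0 := by
  obtain ⟨U, V, hU, hx, hX, hV, rfl⟩ := hp.exists_basic_vertical ξ hv
  rw [← inner_horizontalLift, real_inner_comm, ← basicField_apply_self]
  exact hX.inner_leviCivita_self hU hp hV hx

/-- Ensures that projecting `∇_v X` to `N` loses no information, as `dp` is injective on horizontal
vectors. -/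
lemma IsRiemannianSubmersion.oneillMap_mem_orthogonal (hp : IsRiemannianSubmersion I J p)
    (hF : ∀ q, IsTotallyGeodesicFiber I J p q)
    (ξ : TangentSpace J (p x)) {v : TangentSpace I x} (hv : v ∈ verticalSpace I J p x) :
    hp.oneillMap x ξ v ∈ (verticalSpace I J p x)ᗮ := by
  intro w hw
  obtain ⟨U, V, hU, hx, hX, hV, rfl⟩ := hp.exists_basic_vertical ξ hv
  obtain ⟨U', W, hU', hx', hW, rfl⟩ := hp.exists_isVerticalOn hw
  exact (hX.mono Set.inter_subset_left).inner_leviCivita_vertical (hU.inter hU') hF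
    (hV.mono Set.inter_subset_left) (hW.mono Set.inter_subset_right) ⟨hx, hx'⟩

/-- A Riemannian submersion with totally geodesic fibers from a positively curved manifold is
fat: the O'Neill tensor is nondegenerate. -/
lemma IsRiemannianSubmersion.oneillMap_ne_zero (hp : IsRiemannianSubmersion I J p)
    (hF : ∀ q, IsTotallyGeodesicFiber I J p q) (hK : HasPositiveSectionalCurvature I M)
    {ξ : TangentSpace J (p x)} (hξ : ξ ≠ 0) {v : TangentSpace I x}
    (hv : v ∈ verticalSpace I J p x) (hv0 : v ≠ 0) : hp.oneillMap x ξ v ≠ 0 := by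
  obtain ⟨U, V, hU, hx, hX, hV, rfl⟩ := hp.exists_basic_vertical ξ hv
  intro h0
  have hlift : basicField I J p x ξ x ≠ 0 := fun h ↦ hξ <| by
    rw [← hp.mfderiv_horizontalLift x ξ, ← basicField_apply_self, h, map_zero]
  have horth : inner ℝ (V x) (basicField I J p x ξ x) = 0 := hX.inner_vertical hx hv
  have hli : LinearIndependent ℝ ![basicField I J p x ξ x, V x] := by
    refine linearIndependent_of_ne_zero_of_inner_eq_zero (fun i ↦ ?_) (fun i j hij ↦ ?_)
    · fin_cases i
      exacts [hlift, hv0]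
    · fin_cases i <;> fin_cases j
      exacts [(hij rfl).elim, (real_inner_comm _ _).trans horth, horth, (hij rfl).elim]
  have hpos := hK U (basicField I J p x ξ) V hU
    (fun y hy ↦ (hX.contMDiffAt y hy).contMDiffWithinAt)
    (fun y hy ↦ (hV.contMDiffAt y hy).contMDiffWithinAt) x hx hli
  have h1 : leviCivita I M (basicField I J p x ξ) x (V x) = 0 := h0
  rw [sectionalCurvature, hX.inner_curvature hU hp hF hV hx, h1, inner_zero_left, zero_div] at hpos
  exact hpos.false

/-- For a Riemannian submersion with totally geodesic fibers from a positively curved manifold,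
the vertical vectors at a point define pointwise linearly independent vector fields on the unit
sphere in the horizontal space. -/
theorem IsRiemannianSubmersion.hasIndependentFields (hp : IsRiemannianSubmersion I J p)
    (hF : ∀ q, IsTotallyGeodesicFiber I J p q) (hK : HasPositiveSectionalCurvature I M) (x : M) :
    HasIndependentFields (finrank ℝ E') (fiberDim I J p x) := by
  -- Orthonormal coordinates on the tangent space of `N` stand in for the horizontal space. In them
  -- each vertical basis vector gives a linear, hence smooth, field.
  let φ : TangentSpace J (p x) ≃ₗᵢ[ℝ] EuclideanSpace ℝ (Fin (finrank ℝ E')) :=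
    (stdOrthonormalBasis ℝ (TangentSpace J (p x))).repr
  let u : Basis (Fin (fiberDim I J p x)) ℝ (verticalSpace I J p x) := Module.finBasis ℝ _
  let f (w : verticalSpace I J p x) : EuclideanSpace ℝ (Fin (finrank ℝ E')) →ₗ[ℝ]
      EuclideanSpace ℝ (Fin (finrank ℝ E')) := IsLinearMap.mk'
    (fun c ↦ φ (mfderiv I J p x (hp.oneillMap x (φ.symm c) w)))
    ⟨fun c d ↦ by simp, fun a c ↦ by simp⟩
  refine ⟨fun i ↦ f (u i), fun i ↦ (f (u i)).toContinuousLinearMap.contDiff.contDiffOn,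
    fun i c _ ↦ ?_, fun c hc ↦ ?_⟩
  · change inner ℝ c (φ _) = 0
    rw [← φ.symm.inner_map_map, φ.symm_apply_apply]
    exact hp.inner_oneillMap_self _ (u i).2
  · have hc0 : φ.symm c ≠ 0 := by
      rw [Ne, map_eq_zero_iff _ φ.symm.injective]
      rintro rfl
      simp at hc
    rw [Fintype.linearIndependent_iff]
    intro a ha
    -- A relation among the fields at `c` is the vanishing of the single field attached to `w = ∑ a
    -- i • u i`.
    have hsum : φ (mfderiv I J p x
        (hp.oneillMap x (φ.symm c) (∑ i, a i • u i : verticalSpace I J p x))) = 0 := by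
      rw [← ha]
      simp [f]
    by_contra! hne
    have hw : (∑ i, a i • u i : verticalSpace I J p x) ≠ 0 := fun h ↦ by
      obtain ⟨i, hi⟩ := hne
      exact hi (Fintype.linearIndependent_iff.1 u.linearIndependent a h i)
    set w : verticalSpace I J p x := ∑ i, a i • u i
    rw [map_eq_zero_iff _ φ.injective] at hsum
    -- The vector is now both vertical and horizontal, hence zero, contradicting fatness.
    have hmem : hp.oneillMap x (φ.symm c) w ∈ verticalSpace I J p x := hsum
    have horth := hp.oneillMap_mem_orthogonal hF (φ.symm c) w.2
    exact hp.oneillMap_ne_zero hF hK hc0 w.2 (fun h ↦ hw (Subtype.ext h))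
      (inner_self_eq_zero.1 (horth _ hmem))

end FatBundle

end RiemSubm

end

theorem mainTheorem4 {m n : ℕ}
    {M : Type*} [TopologicalSpace M] [ChartedSpace (EuclideanSpace ℝ (Fin m)) M]
    [IsManifold (𝓡 m) ∞ M] [T2Space M] [CompactSpace M]
    [RiemannianBundle (fun x : M ↦ TangentSpace (𝓡 m) x)]
    [IsContMDiffRiemannianBundle (𝓡 m) ∞ (EuclideanSpace ℝ (Fin m))
      (fun x : M ↦ TangentSpace (𝓡 m) x)]
    {N : Type*} [TopologicalSpace N] [ChartedSpace (EuclideanSpace ℝ (Fin n)) N]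
    [IsManifold (𝓡 n) ∞ N] [T2Space N] [SecondCountableTopology N]
    [RiemannianBundle (fun y : N ↦ TangentSpace (𝓡 n) y)]
    [IsContMDiffRiemannianBundle (𝓡 n) ∞ (EuclideanSpace ℝ (Fin n))
      (fun y : N ↦ TangentSpace (𝓡 n) y)]
    (hn : 0 < n) (hnm : n < m)
    (p : M → N) (hp : RiemSubm.IsRiemannianSubmersion (𝓡 m) (𝓡 n) p)
    (hF : ∀ q : N, RiemSubm.IsTotallyGeodesicFiber (𝓡 m) (𝓡 n) p q)
    (hK : RiemSubm.HasPositiveSectionalCurvature (𝓡 m) M) :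
    ∀ x : M, RiemSubm.fiberDim (𝓡 m) (𝓡 n) p x < RiemSubm.sphereFieldNumber n + 1 := by
  intro x
  have h := hp.hasIndependentFields hF hK x
  rw [finrank_euclideanSpace_fin] at h
  exact Nat.lt_succ_of_le ((RiemSubm.isGreatest_sphereFieldNumber hn).2 h)
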